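/- No constant number of spanning trees can collectively $+2$-span strongly chordal graphs. That is, for every integer $\mu\ge 0$ there is a finite connected simple graph $G$ that is strongly chordal and such that there is no set $\mathcal T$ of at most $\mu$ spanning trees of $G$ with the property that for all vertices $u,v$ of $G$ some $T\in\mathcal T$ satisfies $\mathrm{dist}_T(u,v)\le \mathrm{dist}_G(u,v)+2$. Here a graph is chordal if it has no induced cycle of length greater than $3$, and it is strongly chordal if it is chordal and every (not necessarily induced) cycle of even length at least $6$ in it has an odd chord, i.e. an edge of the graph joining two vertices of the cycle whose distance along the cycle is odd and greater than $1$. -/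

import Mathlib

namespace SimpleGraph

/-- A graph is chordal if it has no induced cycle of length greater than 3. -/
def IsChordal {V : Type*} (G : SimpleGraph V) : Prop :=
  ∀ n : ℕ, 3 < n → ¬ (cycleGraph n).IsIndContained G

/-- A graph is strongly chordal if it is chordal and every cycle of even length at least 6
(a not necessarily induced copy `f` of a cycle graph) has an odd chord: an edge joining two
vertices of the cycle whose distance along the cycle is odd and greater than 1. -/
def IsStronglyChordal {V : Type*} (G : SimpleGraph V) : Prop :=
  G.IsChordal ∧
    ∀ n : ℕ, 6 ≤ n → Even n → ∀ f : Copy (cycleGraph n) G,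
      ∃ a b : Fin n, G.Adj (f a) (f b) ∧
        Odd ((cycleGraph n).dist a b) ∧ 1 < (cycleGraph n).dist a b

/-- `T` is a spanning tree of `G`: a subgraph of `G` on all vertices of `G` that is a tree. -/
def IsSpanningTree {V : Type*} (T G : SimpleGraph V) : Prop :=
  T ≤ G ∧ T.IsTree

/-- The system `𝒯` collectively `+c`-spans `G`: for any two vertices, some tree of the system
realizes their distance in `G` up to the additive surplus `c`. -/
def CollectivelySpans {V : Type*} (𝒯 : Finset (SimpleGraph V)) (c : ℕ)
    (G : SimpleGraph V) : Prop :=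
  ∀ u v : V, ∃ T ∈ 𝒯, T.dist u v ≤ G.dist u v + c

/-- `G` admits a system of (at most) `μ` collective additive tree `c`-spanners. -/
def AdmitsCollectiveTreeSpanners {V : Type*} (G : SimpleGraph V) (μ c : ℕ) : Prop :=
  ∃ 𝒯 : Finset (SimpleGraph V), 𝒯.card ≤ μ ∧ (∀ T ∈ 𝒯, IsSpanningTree T G) ∧
    CollectivelySpans 𝒯 c G

end SimpleGraph

/-! Among vertices of type at most that of `a`, the neighbours of `a` have nested neighbourhoods;
this gives the chords at a vertex of largest type on a cycle.

Against `μ` trees, root each one and choose a leaf `x` that, at every level `t`, avoids the first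
ancestors of `(t, truncate x t)`. For `s < t` the adjacent vertices `(s, x)` and `(t, truncate x t)`
need a tree in which their ancestor chains meet within 3 steps in total. Either an ancestor of `(s,
x)` leaves `x` exactly at level `t`, which for given `s` covers at most `4μ` levels, or the parent
of `(s, x)` is the grandparent of the other vertex and leaves `x` between levels `s` and `t`. A tree
that serves one `s` and many `t` in the second way serves no pair among all but the first of these
`t` in that way, so the trees are used up one by one (`card_le_typeBound`). -/

namespace SimpleGraph

open Finset

/-! ### Rooted trees -/

section Tree

variable {V : Type*} {T : SimpleGraph V}

/-- A parent function of a tree: some edge at each vertex (or a loop), such that every edge joins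
a vertex to its parent. -/
structure IsParent (T : SimpleGraph V) (p : V → V) : Prop where
  eq_or_adj : ∀ v, p v = v ∨ T.Adj v (p v)
  of_adj : ∀ {u v}, T.Adj u v → p u = v ∨ p v = u

/-- The parent is the second vertex of the path to a fixed root; the root, with its empty path, is
its own parent. -/
theorem IsTree.exists_isParent (hT : T.IsTree) : ∃ p : V → V, IsParent T p := by
  classical
  obtain ⟨r⟩ := hT.connected.nonempty
  choose P hP _ using fun v => hT.existsUnique_path v r
  refine ⟨fun v => (P v).snd, fun v => ?_, fun {u v} huv => ?_⟩
  · by_cases h : (P v).Nil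
    · left
      have := h.eq
      subst this
      rw [Walk.eq_nil_iff_nil.2 h]
      rfl
    · exact Or.inr ((P v).adj_snd h)
  · by_cases h : v ∈ (P u).support
    · exact Or.inl (hT.isAcyclic.eq_snd_of_adj_start (hP u) huv h).symm
    · right
      have hc : (Walk.cons huv.symm (P u)).IsPath := (hP u).cons h
      have : P v = Walk.cons huv.symm (P u) := (hT.existsUnique_path v r).unique (hP v) hc
      simp [this]

theorem IsParent.exists_iterate_eq_of_walk {p : V → V} (hp : IsParent T p) {u v : V}
    (w : T.Walk u v) : ∃ i k, i + k ≤ w.length ∧ p^[i] u = p^[k] v := by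
  induction w with
  | nil => exact ⟨0, 0, by simp⟩
  | @cons u a v h w ih =>
    obtain ⟨i, k, hik, e⟩ := ih
    rw [Walk.length_cons]
    rcases hp.of_adj h with h | h
    · exact ⟨i + 1, k, by omega, by rw [Function.iterate_succ_apply, h, e]⟩
    -- Here `u` is the parent of `a`: an ascent from `a` cancels the step, and without one the chain
    -- from `v` grows by one.
    · cases i with
      | zero =>
        refine ⟨0, k + 1, by omega, ?_⟩
        rw [Function.iterate_succ_apply', ← e]
        exact h.symm
      | succ i =>
        refine ⟨i, k, by omega, ?_⟩
        rw [← e, Function.iterate_succ_apply, h]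

theorem IsParent.exists_iterate_eq {p : V → V} (hp : IsParent T p) (hT : T.Connected) (u v : V) :
    ∃ i k, i + k ≤ T.dist u v ∧ p^[i] u = p^[k] v := by
  obtain ⟨w, hw⟩ := hT.exists_walk_length_eq_dist u v
  exact hw ▸ hp.exists_iterate_eq_of_walk w

end Tree

/-! ### The graphs -/

/-- Vertices are pairs of a type and a leaf of the `N`-ary tree of depth `D`. Two vertices are
adjacent if the node that branches off their leaves is at least as deep as both types. -/
def leafGraph (D N : ℕ) : SimpleGraph (Fin D × (Fin D → Fin N)) where
  Adj u v := u ≠ v ∧ ∀ i, i < max u.1 v.1 → u.2 i = v.2 i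
  symm := ⟨fun u v h => ⟨h.1.symm, fun i hi => (h.2 i (by rwa [max_comm])).symm⟩⟩
  loopless := ⟨fun u h => h.1 rfl⟩

section LeafGraph

open scoped Fin.CommRing Fin.NatCast

variable {D N : ℕ}

theorem leafGraph_connected : (leafGraph (D + 1) (N + 1)).Connected := by
  have key : ∀ v, (leafGraph (D + 1) (N + 1)).Reachable v (0, fun _ => 0) := by
    rintro ⟨s, x⟩
    have h1 : (leafGraph (D + 1) (N + 1)).Reachable (s, x) (0, x) := by
      by_cases h : s = 0
      · rw [h]
      · exact Adj.reachable ⟨by simp [h], fun i _ => rfl⟩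
    refine h1.trans ?_
    by_cases h : x = fun _ => 0
    · rw [h]
    · exact Adj.reachable ⟨by simp [h], fun i hi => absurd hi (by simp)⟩
  exact (connected_iff _).2 ⟨fun u v => (key u).trans (key v).symm, ⟨(0, fun _ => 0)⟩⟩

theorem leafGraph_adj_of_common {a y z : Fin D × (Fin D → Fin N)} (hy : (leafGraph D N).Adj a y)
    (hz : (leafGraph D N).Adj a z) (hyz : y ≠ z) (h1 : y.1 ≤ a.1) (h2 : z.1 ≤ a.1) :
    (leafGraph D N).Adj y z := by
  refine ⟨hyz, fun i hi => ?_⟩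
  have hi' : i < a.1 := hi.trans_le (max_le h1 h2)
  exact (hy.2 i (lt_max_of_lt_left hi')).symm.trans (hz.2 i (lt_max_of_lt_left hi'))

/-- Below the type of `a` all three leaves agree through `a` and `y`. On a cycle, `w` and `z` are
three steps apart, so this is the odd chord. -/
theorem leafGraph_adj_of_simple {a y z w : Fin D × (Fin D → Fin N)}
    (hy : (leafGraph D N).Adj a y) (hz : (leafGraph D N).Adj a z) (hw : (leafGraph D N).Adj y w)
    (hwz : w ≠ z) (hw1 : w.1 ≤ a.1) (hy1 : y.1 ≤ a.1) (hzy : z.1 ≤ y.1) :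
    (leafGraph D N).Adj w z := by
  refine ⟨hwz, fun i hi => ?_⟩
  have hi' : i < a.1 := hi.trans_le (max_le hw1 (hzy.trans hy1))
  have hi2 : i < max y.1 w.1 := by
    rw [max_comm]
    exact hi.trans_le (max_le_max le_rfl hzy)
  rw [← hw.2 i hi2, ← hy.2 i (lt_max_of_lt_left hi'), hz.2 i (lt_max_of_lt_left hi')]

theorem Fin.natCast_ne_zero_of_lt {n : ℕ} [NeZero n] {k : ℕ} (hk : k ≠ 0) (h : k < n) :
    (k : Fin n) ≠ 0 := by
  rw [Ne, Fin.natCast_eq_zero]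
  exact fun hd => absurd (Nat.le_of_dvd (Nat.pos_of_ne_zero hk) hd) (by omega)

theorem leafGraph_isChordal : (leafGraph D N).IsChordal := by
  rintro n hn ⟨f⟩
  obtain ⟨n, rfl⟩ : ∃ m, n = m + 2 := ⟨n - 2, by omega⟩
  obtain ⟨a, ha⟩ := Finite.exists_max fun a => (f a).1
  have h1 : (cycleGraph (n + 2)).Adj a (a + 1) := by simp [cycleGraph_adj]
  have h2 : (cycleGraph (n + 2)).Adj a (a - 1) := by simp [cycleGraph_adj]
  have n1 := Fin.natCast_ne_zero_of_lt (n := n + 2) (k := 1) (by omega) (by omega)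
  have n2 := Fin.natCast_ne_zero_of_lt (n := n + 2) (k := 2) (by omega) (by omega)
  have n3 := Fin.natCast_ne_zero_of_lt (n := n + 2) (k := 3) (by omega) (by omega)
  push_cast at n1 n2 n3
  have hne : a + 1 ≠ a - 1 := fun h => n2 (by linear_combination h)
  have h := leafGraph_adj_of_common (f.map_adj_iff.2 h1) (f.map_adj_iff.2 h2)
    (f.injective.ne hne) (ha _) (ha _)
  rw [f.map_adj_iff, cycleGraph_adj] at h
  rcases h with h | h
  · exact n1 (by linear_combination h)
  · exact n3 (by linear_combination -h)

/-- A shorter walk would make one of 1, ..., 5 vanish modulo `n + 2`. -/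
theorem cycleGraph_dist_eq_three {n : ℕ} (hn : 6 ≤ n + 2) (a : Fin (n + 2)) :
    (cycleGraph (n + 2)).dist a (a + 3) = 3 := by
  have n1 := Fin.natCast_ne_zero_of_lt (n := n + 2) (k := 1) (by omega) (by omega)
  have n2 := Fin.natCast_ne_zero_of_lt (n := n + 2) (k := 2) (by omega) (by omega)
  have n3 := Fin.natCast_ne_zero_of_lt (n := n + 2) (k := 3) (by omega) (by omega)
  have n4 := Fin.natCast_ne_zero_of_lt (n := n + 2) (k := 4) (by omega) (by omega)
  have n5 := Fin.natCast_ne_zero_of_lt (n := n + 2) (k := 5) (by omega) (by omega)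
  push_cast at n1 n2 n3 n4 n5
  have e1 : (cycleGraph (n + 2)).Adj a (a + 1) := by simp [cycleGraph_adj]
  have e2 : (cycleGraph (n + 2)).Adj (a + 1) (a + 2) :=
    cycleGraph_adj.2 (Or.inr (by ring))
  have e3 : (cycleGraph (n + 2)).Adj (a + 2) (a + 3) :=
    cycleGraph_adj.2 (Or.inr (by ring))
  have hle : (cycleGraph (n + 2)).dist a (a + 3) ≤ 3 :=
    dist_le (Walk.cons e1 (Walk.cons e2 (Walk.cons e3 Walk.nil)))
  have hr : (cycleGraph (n + 2)).Reachable a (a + 3) :=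
    ⟨Walk.cons e1 (Walk.cons e2 (Walk.cons e3 Walk.nil))⟩
  obtain ⟨w, hw⟩ := hr.exists_walk_length_eq_dist
  rw [← hw] at hle ⊢
  by_contra hne
  have hlt : w.length < 3 := lt_of_le_of_ne hle hne
  clear hw hle hne hr e1 e2 e3
  generalize hb : a + 3 = b at w hlt
  match w, hlt with
  | .nil, _ => exact n3 (by linear_combination hb)
  | .cons h .nil, _ =>
    subst hb
    rcases cycleGraph_adj.1 h with h | h
    · exact n4 (by linear_combination -h)
    · exact n2 (by linear_combination h)
  | .cons h (.cons h' .nil), _ =>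
    subst hb
    rcases cycleGraph_adj.1 h with h | h <;> rcases cycleGraph_adj.1 h' with h' | h'
    · exact n5 (by linear_combination -h - h')
    · exact n3 (by linear_combination h' - h)
    · exact n3 (by linear_combination h - h')
    · exact n1 (by linear_combination h + h')
  | .cons _ (.cons _ (.cons _ w)), hlt => simp at hlt; omega

theorem leafGraph_isStronglyChordal : (leafGraph D N).IsStronglyChordal := by
  refine ⟨leafGraph_isChordal, fun n hn _ f => ?_⟩
  obtain ⟨n, rfl⟩ : ∃ m, n = m + 2 := ⟨n - 2, by omega⟩
  obtain ⟨a, ha⟩ := Finite.exists_max fun a => (f a).1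
  have n3 := Fin.natCast_ne_zero_of_lt (n := n + 2) (k := 3) (by omega) (by omega)
  push_cast at n3
  have adj : ∀ b, (leafGraph D N).Adj (f b) (f (b + 1)) := fun b =>
    f.toHom.map_adj (by simp [cycleGraph_adj])
  have chord : ∀ b, (leafGraph D N).Adj (f b) (f (b + 3)) → ∃ a b : Fin (n + 2),
      (leafGraph D N).Adj (f a) (f b) ∧ Odd ((cycleGraph (n + 2)).dist a b) ∧
        1 < (cycleGraph (n + 2)).dist a b := fun b hb =>
    ⟨b, b + 3, hb, by rw [cycleGraph_dist_eq_three hn]; decide,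
      by rw [cycleGraph_dist_eq_three hn]; decide⟩
  have hp : (leafGraph D N).Adj (f a) (f (a - 1)) := by
    simpa using (adj (a - 1)).symm
  rcases le_total (f (a - 1)).1 (f (a + 1)).1 with hle | hle
  · apply chord (a - 1)
    have hw : (leafGraph D N).Adj (f (a + 1)) (f (a - 1 + 3)) := by
      convert adj (a + 1) using 2
      ring
    exact (leafGraph_adj_of_simple (adj a) hp hw
      (f.injective.ne fun h => n3 (by linear_combination h)) (ha _) (ha _) hle).symm
  · apply chord (a - 2)
    have e : a - 2 + 3 = a + 1 := by ring
    rw [e]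
    have hw : (leafGraph D N).Adj (f (a - 1)) (f (a - 2)) := by
      convert (adj (a - 2)).symm using 2
      ring
    exact leafGraph_adj_of_simple hp (adj a) hw
      (f.injective.ne fun h => n3 (by linear_combination -h)) (ha _) (ha _) hle

end LeafGraph

/-! ### Systems of labels -/

/-- The number of types that `k` trees can serve, if `m` types are exempt at each type. -/
def typeBound (m : ℕ) : ℕ → ℕ
  | 0 => m + 1
  | k + 1 => m + 1 + (k + 1) * (typeBound m k + 1)

theorem card_le_typeBound {ι : Type*} [DecidableEq ι] {D m : ℕ} (f : Fin D → Finset ℕ)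
    (hf : ∀ s, #(f s) ≤ m) (a b : ι → Fin D → ℕ) (J : Finset ι) (S : Finset (Fin D))
    (h : ∀ s ∈ S, ∀ t ∈ S, s < t → (t : ℕ) ∈ f s ∨
      ∃ j ∈ J, a j s = b j t ∧ (s : ℕ) ≤ a j s ∧ a j s ≤ t) :
    #S ≤ typeBound m #J := by
  induction hk : #J generalizing J S with
  | zero =>
    rw [card_eq_zero] at hk
    subst hk
    rcases S.eq_empty_or_nonempty with rfl | hS
    · simp
    have hsub : (S.erase (S.min' hS)).map Fin.valEmbedding ⊆ f (S.min' hS) := by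
      intro c hc
      obtain ⟨t, ht, rfl⟩ := mem_map.1 hc
      have ht' := mem_of_mem_erase ht
      simpa using h _ (S.min'_mem hS) t ht' (S.min'_lt_of_mem_erase_min' hS ht)
    have := (card_le_card hsub).trans (hf _)
    rw [card_map, card_erase_of_mem (S.min'_mem hS)] at this
    simp only [typeBound]
    omega
  | succ k ih =>
    by_contra! hlt
    have hS : S.Nonempty := card_pos.1 (by omega)
    set s := S.min' hS with hs
    have hsS : s ∈ S := S.min'_mem hS
    set S' := (S.erase s).filter fun t : Fin D => (t : ℕ) ∉ f s with hS'
    have hexempt : #((S.erase s).filter fun t : Fin D => (t : ℕ) ∈ f s) ≤ m := by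
      refine le_trans ?_ (hf s)
      rw [← card_map Fin.valEmbedding]
      apply card_le_card
      intro c hc
      obtain ⟨t, ht, rfl⟩ := mem_map.1 hc
      exact (mem_filter.1 ht).2
    have hsplit : #((S.erase s).filter fun t : Fin D => (t : ℕ) ∈ f s) + #S' = #(S.erase s) := by
      convert card_filter_add_card_filter_not _
    rw [card_erase_of_mem hsS] at hsplit
    simp only [typeBound] at hlt
    have hcard : #J * (typeBound m k + 1) < #S' := by
      rw [hk]
      omega
    have hex : ∀ t ∈ S', ∃ j ∈ J, a j s = b j t ∧ (s : ℕ) ≤ a j s ∧ a j s ≤ t := by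
      intro t ht
      obtain ⟨ht, htf⟩ := mem_filter.1 ht
      exact (h s hsS t (mem_of_mem_erase ht) (S.min'_lt_of_mem_erase_min' hS ht)).resolve_left htf
    have : Nonempty ι := (card_pos.1 (by omega : 0 < #J)).to_subtype.map Subtype.val
    choose! g hgJ hg using hex
    obtain ⟨j, hj, hlarge⟩ := exists_lt_card_fiber_of_mul_lt_card_of_maps_to hgJ hcard
    set R := S'.filter fun t => g t = j with hR
    have hRS : ∀ t ∈ R, t ∈ S := fun t ht =>
      mem_of_mem_erase (mem_filter.1 (mem_filter.1 ht).1).1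
    have hRj : ∀ t ∈ R, a j s = b j t ∧ a j s ≤ t := by
      intro t ht
      obtain ⟨htS, rfl⟩ := mem_filter.1 ht
      exact ⟨(hg t htS).1, (hg t htS).2.2⟩
    have hRne : R.Nonempty := card_pos.1 (by omega)
    have key := ih (J.erase j) (R.erase (R.min' hRne)) ?_ (by rw [card_erase_of_mem hj, hk]; rfl)
    · rw [card_erase_of_mem (R.min'_mem hRne)] at key
      omega
    · intro t ht u hu htu
      have htR := mem_of_mem_erase ht
      have huR := mem_of_mem_erase hu
      refine (h t (hRS t htR) u (hRS u huR) htu).imp_right ?_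
      rintro ⟨i, hi, h1, h2, h3⟩
      refine ⟨i, mem_erase.2 ⟨?_, hi⟩, h1, h2, h3⟩
      -- Serving `t < u` by the tree `j` again would force its label at `t` to be `a j s`, which is
      -- at most `R.min'` and so below `t`.
      rintro rfl
      have h4 : R.min' hRne < t := R.min'_lt_of_mem_erase_min' hRne ht
      have h5 := (hRj _ (R.min'_mem hRne)).2
      have h6 := (hRj u huR).1
      have h7 : ((R.min' hRne : Fin D) : ℕ) < t := h4
      omega

/-! ### Choice of the leaves -/

section Leaves

variable {D N : ℕ}

/-- The leaf that follows `x` down to level `t` and takes the first child from there on. -/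
def truncate (x : Fin D → Fin (N + 1)) (t : Fin D) : Fin D → Fin (N + 1) :=
  fun i => if i < t then x i else 0

theorem truncate_congr {x y : Fin D → Fin (N + 1)} {t : Fin D} (h : ∀ i < t, x i = y i) :
    truncate x t = truncate y t := by
  funext i
  unfold truncate
  split_ifs with hi
  · exact h i hi
  · rfl

/-- Greedy choice by levels: `truncate x t` depends only on the levels below `t`. -/
theorem exists_leaf_avoiding (B : Fin D → (Fin D → Fin (N + 1)) → Finset (Fin (N + 1)))
    (hB : ∀ t z, #(B t z) ≤ N) : ∃ x : Fin D → Fin (N + 1), ∀ t, x t ∉ B t (truncate x t) := by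
  have key : ∀ n, ∃ x : Fin D → Fin (N + 1), ∀ t : Fin D, (t : ℕ) < n →
      x t ∉ B t (truncate x t) := by
    intro n
    induction n with
    | zero => exact ⟨fun _ => 0, fun t ht => absurd ht (by omega)⟩
    | succ n ih =>
      obtain ⟨x, hx⟩ := ih
      by_cases hn : n < D
      · obtain ⟨c, -, hc⟩ := exists_mem_notMem_of_card_lt_card
          (s := B ⟨n, hn⟩ (truncate x ⟨n, hn⟩)) (t := univ)
          (by simpa using Nat.lt_succ_of_le (hB _ _))
        refine ⟨Function.update x ⟨n, hn⟩ c, fun t ht => ?_⟩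
        have e : truncate (Function.update x ⟨n, hn⟩ c) t = truncate x t := by
          refine truncate_congr fun i hi => Function.update_of_ne ?_ _ _
          rintro rfl
          have : n < (t : ℕ) := hi
          omega
        rw [e]
        rcases Nat.lt_succ_iff_lt_or_eq.1 ht with h | h
        · rw [Function.update_of_ne (by rintro rfl; simp at h)]
          exact hx t h
        · obtain rfl : t = ⟨n, hn⟩ := Fin.ext h
          simpa using hc
      · exact ⟨x, fun t _ => hx t (by omega)⟩
  obtain ⟨x, hx⟩ := key D
  exact ⟨x, fun t => hx t t.2⟩

/-- The level at which the leaf `w` branches off `x`. -/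
noncomputable def branchLevel (x w : Fin D → Fin N) : ℕ :=
  sInf {c | ∃ h : c < D, w ⟨c, h⟩ ≠ x ⟨c, h⟩}

theorem le_branchLevel {x w : Fin D → Fin N} {s t : Fin D} (h : ∀ i < s, w i = x i)
    (ht : w t ≠ x t) : (s : ℕ) ≤ branchLevel x w := by
  refine le_csInf ⟨t, t.2, ht⟩ ?_
  rintro c ⟨hc, hne⟩
  by_contra! hlt
  exact hne (h ⟨c, hc⟩ hlt)

theorem branchLevel_le {x w : Fin D → Fin N} {t : Fin D} (ht : w t ≠ x t) :
    branchLevel x w ≤ t :=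
  Nat.sInf_le (Exists.intro t.2 ht)

theorem branchLevel_eq {x w : Fin D → Fin N} {t : Fin D} (h : ∀ i < t, w i = x i)
    (ht : w t ≠ x t) : branchLevel x w = t :=
  le_antisymm (branchLevel_le ht) (le_branchLevel h ht)

theorem IsParent.agree {T : SimpleGraph (Fin D × (Fin D → Fin N))} (hT : T ≤ leafGraph D N)
    {p : Fin D × (Fin D → Fin N) → Fin D × (Fin D → Fin N)} (hp : IsParent T p)
    (v : Fin D × (Fin D → Fin N)) {i : Fin D} (hi : i < v.1) : (p v).2 i = v.2 i := by
  rcases hp.eq_or_adj v with h | h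
  · rw [h]
  · exact ((hT h).2 i (lt_max_of_lt_left hi)).symm

theorem IsParent.branchLevel_of_dist_le_three {T : SimpleGraph (Fin D × (Fin D → Fin N))}
    (hT : T ≤ leafGraph D N) (hc : T.Connected)
    {p : Fin D × (Fin D → Fin N) → Fin D × (Fin D → Fin N)} (hp : IsParent T p)
    {x z : Fin D → Fin N} {s t : Fin D} (hz : ∀ i < t, z i = x i)
    (hav : ∀ k < 4, (p^[k] (t, z)).2 t ≠ x t) (hd : T.dist (s, x) (t, z) ≤ 3) :
    (∃ i < 4, branchLevel x (p^[i] (s, x)).2 = t) ∨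
      (branchLevel x (p (s, x)).2 = branchLevel x (p (p (t, z))).2 ∧
        (s : ℕ) ≤ branchLevel x (p (s, x)).2 ∧ branchLevel x (p (s, x)).2 ≤ t) := by
  obtain ⟨i, k, hik, e⟩ := hp.exists_iterate_eq hc (s, x) (t, z)
  have hk := hav k (by omega)
  have hi0 : i ≠ 0 := by
    rintro rfl
    rw [← e] at hk
    exact hk rfl
  -- A parent keeps the coordinates below the type of its child, so for `k ≤ 1` the meeting vertex
  -- still follows `x` down to `t`; a grandparent need not.
  rcases Nat.lt_or_ge k 2 with hk2 | hk2
  · refine Or.inl ⟨i, by omega, ?_⟩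
    rw [e]
    refine branchLevel_eq (fun c hc => ?_) hk
    rcases (by omega : k = 0 ∨ k = 1) with rfl | rfl
    · exact hz c hc
    · exact (hp.agree hT (t, z) hc).trans (hz c hc)
  · obtain ⟨rfl, rfl⟩ : k = 2 ∧ i = 1 := by omega
    right
    have e' : p (s, x) = p (p (t, z)) := e
    have hk' : (p (s, x)).2 t ≠ x t := by rw [e']; exact hk
    exact ⟨by rw [e'], le_branchLevel (fun c hc => hp.agree hT (s, x) hc) hk', branchLevel_le hk'⟩

end Leaves

/-- The factor 4 counts the iterates 0, ..., 3 in each tree. One child more than the `4μ` forbidden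
ones suffices. -/
theorem leafGraph_not_admits (μ : ℕ) :
    ¬ (leafGraph (typeBound (μ * 4) μ + 1) (μ * 4 + 1)).AdmitsCollectiveTreeSpanners μ 2 := by
  classical
  set D := typeBound (μ * 4) μ + 1 with hD
  rintro ⟨𝒯, hcard, htree, hspan⟩
  have hpar : ∀ T ∈ 𝒯, ∃ p, IsParent T p := fun T hT => (htree T hT).2.exists_isParent
  choose! p hp using hpar
  have hbound : ∀ g : SimpleGraph (Fin D × (Fin D → Fin (μ * 4 + 1))) × ℕ → ℕ,
      #((𝒯 ×ˢ range 4).image g) ≤ μ * 4 := fun g =>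
    card_image_le.trans (by rw [card_product, card_range]; omega)
  obtain ⟨x, hx⟩ := exists_leaf_avoiding (D := D) (N := μ * 4)
    (fun t z => (𝒯 ×ˢ range 4).image fun q => ((p q.1)^[q.2] (t, z)).2 t)
    (fun t z => card_image_le.trans (by rw [card_product, card_range]; omega))
  have key := card_le_typeBound (m := μ * 4)
    (fun s => (𝒯 ×ˢ range 4).image fun q => branchLevel x ((p q.1)^[q.2] (s, x)).2)
    (fun s => hbound _) (fun T s => branchLevel x (p T (s, x)).2)
    (fun T t => branchLevel x (p T (p T (t, truncate x t))).2) 𝒯 univ ?_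
  · have mono : Monotone (typeBound (μ * 4)) := by
      refine monotone_nat_of_le_succ fun k => ?_
      rw [typeBound]
      nlinarith
    have := key.trans (mono hcard)
    rw [card_univ, Fintype.card_fin] at this
    omega
  · intro s _ t _ hst
    have hz : ∀ i < t, truncate x t i = x i := fun i hi => if_pos hi
    have hadj : (leafGraph D (μ * 4 + 1)).Adj (s, x) (t, truncate x t) :=
      ⟨by simp [hst.ne], fun i hi => (hz i (by simpa [max_eq_right hst.le] using hi)).symm⟩
    obtain ⟨T, hT, hd⟩ := hspan (s, x) (t, truncate x t)
    rw [dist_eq_one_iff_adj.2 hadj] at hd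
    rcases (hp T hT).branchLevel_of_dist_le_three (htree T hT).1 (htree T hT).2.connected hz
      (fun k hk he => hx t (mem_image.2
        ⟨(T, k), mem_product.2 ⟨hT, mem_range.2 hk⟩, he⟩)) hd with ⟨i, hi, h⟩ | h
    · exact Or.inl (mem_image.2 ⟨(T, i), mem_product.2 ⟨hT, mem_range.2 hi⟩, h⟩)
    · exact Or.inr ⟨T, hT, h⟩

end SimpleGraph

theorem mainTheorem3 (μ : ℕ) :
    ∃ (V : Type) (_ : Finite V) (G : SimpleGraph V),
      G.Connected ∧ G.IsStronglyChordal ∧ ¬ G.AdmitsCollectiveTreeSpanners μ 2 :=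
  ⟨_, inferInstance, _, SimpleGraph.leafGraph_connected, SimpleGraph.leafGraph_isStronglyChordal,
    SimpleGraph.leafGraph_not_admits μ⟩
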